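/- Let $n\ge 0$ and let $\mathfrak S_n(312)$ be the set of permutations $\sigma$ of $\{1,\dots,n\}$ that avoid the pattern $312$, i.e. for which there are no $i<j<k$ with $\sigma(j)<\sigma(k)<\sigma(i)$. For a permutation $\sigma$ of $\{1,\dots,n\}$ let $\mathrm{maj}(\sigma)$ be its major index, the sum of all $j$ with $1\le j\le n-1$ and $\sigma(j)>\sigma(j+1)$, and put $$\mathcal A(q,t)=\sum_{\sigma\in\mathfrak S_n(312)}q^{\mathrm{maj}(\sigma)}\,t^{\mathrm{maj}(\sigma^{-1})}\in\mathbb Z[q,t].$$ Then, as an identity of rational functions in the indeterminate $q$ (over $\mathbb Q$), $$\mathcal A(q,q)=\frac{1}{[n+1]}\genfrac{[}{]}{0pt}{}{2n}{n},$$ where $[m]=\sum_{i=0}^{m-1}q^i$, $\genfrac{[}{]}{0pt}{}{m}{k}=\frac{(q)_m}{(q)_k(q)_{m-k}}$ for $0\le k\le m$, and $(q)_m=(1-q)(1-q^2)\cdots(1-q^m)$. -/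

import Mathlib

namespace QCatalan

/-- The `q`-integer `[n] = 1 + q + ⋯ + q^(n-1)`. -/
def qInt {R : Type*} [CommRing R] (q : R) (n : ℕ) : R :=
  ∑ i ∈ Finset.range n, q ^ i

/-- The `q`-shifted factorial `(x; q)_n = (1 - x)(1 - q x) ⋯ (1 - q^(n-1) x)`. -/
def qPochhammer {R : Type*} [CommRing R] (x q : R) (n : ℕ) : R :=
  ∏ i ∈ Finset.range n, (1 - q ^ i * x)

/-- The Gaussian binomial `(q; q)_n / ((q; q)_k (q; q)_(n-k))`, for `k ≤ n`
and `q` not a root of unity (in the theorem, `q` is an indeterminate). -/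
def qBinom {K : Type*} [Field K] (q : K) (n k : ℕ) : K :=
  qPochhammer q q n / (qPochhammer q q k * qPochhammer q q (n - k))

/-- Descents of a finite sequence. The index `j : Fin n` stands for the position `j + 1`. -/
def descents {α : Type*} [LinearOrder α] {n : ℕ} (f : Fin n → α) : Finset (Fin n) :=
  Finset.univ.filter fun j => ∃ h : (j : ℕ) + 1 < n, f ⟨(j : ℕ) + 1, h⟩ < f j

/-- The major index: the sum of the descent positions, counted from `1`. -/
def maj {α : Type*} [LinearOrder α] {n : ℕ} (f : Fin n → α) : ℕ :=
  ∑ j ∈ descents f, ((j : ℕ) + 1)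

/-- `σ` is `312`-avoiding: there are no `i < j < k` with `σ j < σ k < σ i`. -/
def Avoids312 {n : ℕ} (σ : Equiv.Perm (Fin n)) : Prop :=
  ∀ i j k : Fin n, i < j → j < k → ¬ (σ j < σ k ∧ σ k < σ i)

instance {n : ℕ} : DecidablePred (Avoids312 (n := n)) := fun σ =>
  inferInstanceAs
    (Decidable (∀ i j k : Fin n, i < j → j < k → ¬ (σ j < σ k ∧ σ k < σ i)))

/-- The polynomial `A(q, t) = ∑ q^(maj σ) t^(maj σ⁻¹)` over the `312`-avoiding permutations `σ`
of `n` letters; `q` is the variable `0` and `t` is the variable `1`. -/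
noncomputable def genFun (n : ℕ) : MvPolynomial (Fin 2) ℤ :=
  ∑ σ : Equiv.Perm (Fin n) with Avoids312 σ,
    MvPolynomial.X 0 ^ maj σ * MvPolynomial.X 1 ^ maj (σ⁻¹ : Equiv.Perm (Fin n))

end QCatalan

/-! Each permutation of n + 1 letters arises once by inserting the new maximum into a permutation of
n letters. The result avoids 312 iff the old one does and the new maximum lands immediately before
the old maximum or anywhere after it. A 312-avoider decreases from its maximum on, so `majSum` grows
by j when the new maximum goes after the old one with j letters behind it, and by 2n when it goes
immediately before. Hence `majSum` and the number of letters after the maximum obey a closed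
recurrence, `refinedSum_succ`. The explicit products `tailSum` solve it (`refinedSum_eq`), and their
value at j = 0 is the q-Catalan number (`tailSum_zero`). -/

namespace QCatalan

/-! ### Inserting a maximum: avoidance, major indices and the resulting recurrence. -/

section Insertion

/-- Insert a new maximum at position `p` of the word of `σ`. -/
def insertMax {n : ℕ} (p : Fin (n + 1)) (σ : Equiv.Perm (Fin n)) : Equiv.Perm (Fin (n + 1)) :=
  (finSuccEquiv' p).trans ((Equiv.optionCongr σ).trans (finSuccEquiv' (Fin.last n)).symm)

variable {n : ℕ}

@[simp]
lemma insertMax_apply_self (p : Fin (n + 1)) (σ : Equiv.Perm (Fin n)) :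
    insertMax p σ p = Fin.last n := by
  simp [insertMax]

@[simp]
lemma insertMax_apply_succAbove (p : Fin (n + 1)) (σ : Equiv.Perm (Fin n)) (i : Fin n) :
    insertMax p σ (p.succAbove i) = (σ i).castSucc := by
  simp [insertMax]

@[simp]
lemma insertMax_inv_last (p : Fin (n + 1)) (σ : Equiv.Perm (Fin n)) :
    (insertMax p σ)⁻¹ (Fin.last n) = p := by
  rw [Equiv.Perm.inv_eq_iff_eq, insertMax_apply_self]

@[simp]
lemma insertMax_inv_castSucc (p : Fin (n + 1)) (σ : Equiv.Perm (Fin n)) (i : Fin n) :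
    (insertMax p σ)⁻¹ i.castSucc = p.succAbove (σ⁻¹ i) := by
  rw [Equiv.Perm.inv_eq_iff_eq, insertMax_apply_succAbove]
  simp

lemma insertMax_bijective :
    Function.Bijective
      (fun x : Fin (n + 1) × Equiv.Perm (Fin n) => insertMax x.1 x.2) := by
  rw [Fintype.bijective_iff_injective_and_card]
  refine ⟨?_, by simp [Fintype.card_perm, Nat.factorial_succ]⟩
  rintro ⟨p, σ⟩ ⟨p', σ'⟩ h
  dsimp only at h
  have hp : p = p' := by
    rw [← insertMax_inv_last p σ, h, insertMax_inv_last]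
  subst hp
  have hσ : σ = σ' := by
    ext i : 1
    have := congrArg (fun τ : Equiv.Perm (Fin (n + 1)) => τ (p.succAbove i)) h
    simpa using this
  rw [hσ]

/-- The new maximum can only play the 3. If it stands before the old maximum with a letter between,
these three form a 312; otherwise the old maximum can replace it in any 312. -/
lemma avoids312_insertMax_iff (p : Fin (n + 2)) (σ : Equiv.Perm (Fin (n + 1))) :
    Avoids312 (insertMax p σ) ↔ Avoids312 σ ∧ (σ⁻¹ (Fin.last n)).castSucc ≤ p := by
  set m := σ⁻¹ (Fin.last n) with hm
  have hσm : σ m = Fin.last n := by simp [hm]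
  constructor
  · intro h
    refine ⟨fun i j k hij hjk hσ => ?_, ?_⟩
    · refine h (p.succAbove i) (p.succAbove j) (p.succAbove k)
        (Fin.succAbove_lt_succAbove_iff.2 hij) (Fin.succAbove_lt_succAbove_iff.2 hjk) ?_
      simpa using hσ
    · by_contra! hp
      have hpn : (p : ℕ) < n + 1 := lt_trans (Fin.lt_def.1 hp) m.is_lt
      -- The old letter that ends up immediately after the new maximum.
      let a : Fin (n + 1) := ⟨p, hpn⟩
      have ham : a < m := hp
      refine h p (p.succAbove a) (p.succAbove m) ?_
        (Fin.succAbove_lt_succAbove_iff.2 ham) ?_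
      · exact (Fin.lt_succAbove_iff_le_castSucc p a).2 (le_of_eq rfl)
      · simp only [insertMax_apply_succAbove, insertMax_apply_self, hσm]
        refine ⟨?_, Fin.castSucc_lt_last _⟩
        rw [Fin.castSucc_lt_castSucc_iff]
        refine lt_of_le_of_ne (Fin.le_last _) fun he => ham.ne ?_
        exact σ.injective (he.trans hσm.symm)
  · rintro ⟨h, hp⟩ i j k hij hjk ⟨h1, h2⟩
    have hj : j ≠ p := by
      rintro rfl
      rw [insertMax_apply_self] at h1
      exact absurd h1 (Fin.le_last _).not_gt
    have hk : k ≠ p := by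
      rintro rfl
      rw [insertMax_apply_self] at h2
      exact absurd h2 (Fin.le_last _).not_gt
    obtain ⟨j, rfl⟩ := Fin.exists_succAbove_eq hj
    obtain ⟨k, rfl⟩ := Fin.exists_succAbove_eq hk
    rw [Fin.succAbove_lt_succAbove_iff] at hjk
    simp only [insertMax_apply_succAbove, Fin.castSucc_lt_castSucc_iff] at h1
    by_cases hi : i = p
    · subst hi
      rw [Fin.lt_succAbove_iff_le_castSucc] at hij
      have hmj : m ≤ j := Fin.castSucc_le_castSucc_iff.1 (hp.trans hij)
      have hmj' : m < j := by
        refine lt_of_le_of_ne hmj fun he => ?_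
        rw [← he, hσm] at h1
        exact absurd h1 (Fin.le_last _).not_gt
      refine h m j k hmj' hjk ⟨h1, hσm ▸ lt_of_le_of_ne (Fin.le_last _) fun he => ?_⟩
      exact (hmj'.trans hjk).ne (σ.injective (hσm.trans he.symm))
    · obtain ⟨i, rfl⟩ := Fin.exists_succAbove_eq hi
      rw [Fin.succAbove_lt_succAbove_iff] at hij
      simp only [insertMax_apply_succAbove, Fin.castSucc_lt_castSucc_iff] at h2
      exact h i j k hij hjk ⟨h1, h2⟩

lemma maj_eq_sum_fin {α : Type*} [LinearOrder α] (f : Fin (n + 1) → α) :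
    maj f = ∑ i : Fin n, if f i.succ < f i.castSucc then (i : ℕ) + 1 else 0 := by
  unfold maj descents
  rw [Finset.sum_filter, Fin.sum_univ_castSucc]
  simp [Fin.succ]

/-- Descents of the inverse record letters i + 1 standing to the left of i. Insertion preserves the
relative order of old letters, so only the two largest letters give a new comparison. -/
lemma maj_insertMax_inv (p : Fin (n + 2)) (σ : Equiv.Perm (Fin (n + 1)))
    (hp : (σ⁻¹ (Fin.last n)).castSucc ≤ p) :
    maj ((insertMax p σ)⁻¹ : Equiv.Perm (Fin (n + 2))) =
      maj (σ⁻¹ : Equiv.Perm (Fin (n + 1))) + if (σ⁻¹ (Fin.last n)).castSucc = p then n + 1 else 0 := by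
  rw [maj_eq_sum_fin, maj_eq_sum_fin, Fin.sum_univ_castSucc]
  congr 1
  · refine Finset.sum_congr rfl fun i _ => ?_
    rw [← Fin.castSucc_succ, insertMax_inv_castSucc, insertMax_inv_castSucc]
    exact if_congr Fin.succAbove_lt_succAbove_iff rfl rfl
  · rw [Fin.succ_last, insertMax_inv_last, insertMax_inv_castSucc]
    exact if_congr ((Fin.lt_succAbove_iff_le_castSucc _ _).trans
      ⟨fun h => le_antisymm hp h, fun h => h.ge⟩) rfl rfl

/-- The word of a permutation, as a sequence of natural numbers. -/
def word (σ : Equiv.Perm (Fin n)) (i : ℕ) : ℕ :=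
  if h : i < n then (σ ⟨i, h⟩ : ℕ) else 0

lemma word_of_lt (σ : Equiv.Perm (Fin n)) {i : ℕ} (h : i < n) : word σ i = σ ⟨i, h⟩ :=
  dif_pos h

lemma maj_eq_sum_word (σ : Equiv.Perm (Fin (n + 1))) :
    maj σ = ∑ i ∈ Finset.range n, if word σ (i + 1) < word σ i then i + 1 else 0 := by
  rw [maj_eq_sum_fin, Finset.sum_range]
  refine Finset.sum_congr rfl fun i _ => ?_
  rw [word_of_lt σ (by omega : (i : ℕ) + 1 < n + 1), word_of_lt σ (by omega : (i : ℕ) < n + 1)]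
  rfl

lemma word_insertMax_of_lt (p : Fin (n + 1)) (σ : Equiv.Perm (Fin n)) {i : ℕ}
    (hi : i < p) : word (insertMax p σ) i = word σ i := by
  have hin : i < n := by omega
  rw [word_of_lt _ (by omega : i < n + 1), word_of_lt _ hin]
  have := insertMax_apply_succAbove p σ ⟨i, hin⟩
  rw [Fin.succAbove_of_castSucc_lt _ _ (by exact hi)] at this
  exact congrArg Fin.val this

lemma word_insertMax_self (p : Fin (n + 1)) (σ : Equiv.Perm (Fin n)) :
    word (insertMax p σ) p = n := by
  rw [word_of_lt _ p.is_lt]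
  exact congrArg Fin.val (insertMax_apply_self p σ)

lemma word_insertMax_succ (p : Fin (n + 1)) (σ : Equiv.Perm (Fin n)) {i : ℕ}
    (hi : p ≤ i) (hin : i < n) : word (insertMax p σ) (i + 1) = word σ i := by
  rw [word_of_lt _ (by omega : i + 1 < n + 1), word_of_lt _ hin]
  have := insertMax_apply_succAbove p σ ⟨i, hin⟩
  rw [Fin.succAbove_of_le_castSucc _ _ (by exact hi)] at this
  exact congrArg Fin.val this

lemma word_lt (σ : Equiv.Perm (Fin n)) {i : ℕ} (h : i < n) : word σ i < n := by
  rw [word_of_lt σ h]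
  exact Fin.is_lt _

lemma word_injOn (σ : Equiv.Perm (Fin n)) {i j : ℕ} (hi : i < n) (hj : j < n)
    (h : word σ i = word σ j) : i = j := by
  rw [word_of_lt σ hi, word_of_lt σ hj] at h
  simpa using σ.injective (Fin.ext h)

lemma word_position_last (σ : Equiv.Perm (Fin (n + 1))) :
    word σ (σ⁻¹ (Fin.last n)) = n := by
  rw [word_of_lt σ (Fin.is_lt _)]
  simp

/-- A `312`-avoiding permutation decreases from its maximum on. -/
lemma Avoids312.word_succ_lt {σ : Equiv.Perm (Fin (n + 1))} (h : Avoids312 σ) {i : ℕ}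
    (hi : σ⁻¹ (Fin.last n) ≤ i) (hin : i < n) : word σ (i + 1) < word σ i := by
  have hlast := word_position_last σ
  set m := σ⁻¹ (Fin.last n) with hm
  have hne : word σ (i + 1) ≠ word σ i := fun he => by
    have := word_injOn σ (by omega) (by omega) he
    omega
  have hne' : word σ (i + 1) ≠ n := fun he => by
    have := word_injOn σ (by omega) (by omega) (he.trans hlast.symm)
    omega
  have hlt := word_lt σ (by omega : i + 1 < n + 1)
  rcases hi.eq_or_lt with he | hlt'
  · have : word σ i = n := he ▸ hlast
    omega
  · by_contra! hle
    refine h m ⟨i, by omega⟩ ⟨i + 1, by omega⟩ hlt' (by simp [Fin.lt_def]) ⟨?_, ?_⟩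
    · rw [Fin.lt_def, ← word_of_lt, ← word_of_lt]
      omega
    · have : σ m = Fin.last n := by simp [hm]
      rw [this, Fin.lt_def, ← word_of_lt, Fin.val_last]
      omega

/-- From the old maximum on every position is a descent. Those from the insertion point on shift by
one, the new maximum adds a descent unless it is last, and the step into it is an ascent, which
destroys a descent exactly when the old maximum is to its left. -/
lemma maj_insertMax (p : Fin (n + 2)) (σ : Equiv.Perm (Fin (n + 1))) (h : Avoids312 σ)
    (hp : (σ⁻¹ (Fin.last n)).castSucc ≤ p) :
    maj (insertMax p σ) =
      maj σ + if (σ⁻¹ (Fin.last n)).castSucc = p then n + 1 else n + 1 - p := by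
  rw [maj_eq_sum_word, maj_eq_sum_word]
  have hdesc := fun i : ℕ => h.word_succ_lt (i := i)
  have hlast := word_position_last σ
  have hm : ((σ⁻¹ (Fin.last n) : Fin (n + 1)) : ℕ) < n + 1 := Fin.is_lt _
  simp only [Fin.le_def, Fin.ext_iff, Fin.val_castSucc] at hp ⊢
  generalize ((σ⁻¹ (Fin.last n) : Fin (n + 1)) : ℕ) = m at *
  have hpn : (p : ℕ) ≤ n + 1 := by omega
  have hasc : ∀ i, i + 1 = (p : ℕ) →
      ¬ word (insertMax p σ) (i + 1) < word (insertMax p σ) i := fun i hi => by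
    rw [hi, word_insertMax_self, word_insertMax_of_lt p σ (by omega)]
    exact (word_lt σ (by omega)).le.not_gt
  have hbelow : ∀ t < (p : ℕ), ∑ i ∈ Finset.range t,
        (if word (insertMax p σ) (i + 1) < word (insertMax p σ) i then i + 1 else 0) =
        ∑ i ∈ Finset.range t, if word σ (i + 1) < word σ i then i + 1 else 0 := fun t ht => by
    refine Finset.sum_congr rfl fun i hi => ?_
    have := Finset.mem_range.1 hi
    rw [word_insertMax_of_lt p σ (by omega), word_insertMax_of_lt p σ (by omega)]
  rcases hpn.eq_or_lt with hpe | hpl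
  · rw [Finset.sum_range_succ, if_neg (hasc n hpe.symm), hbelow n (by omega),
      if_neg (by omega)]
    omega
  · obtain ⟨r, hr⟩ := Nat.exists_eq_add_of_le (Nat.lt_succ_iff.1 hpl)
    have hnew : ∑ x ∈ Finset.range (r + 1),
        (if word (insertMax p σ) (p + x + 1) < word (insertMax p σ) (p + x)
          then p + x + 1 else 0) = ∑ x ∈ Finset.range r, (p + x + 1 + 1) + (p + 1) := by
      rw [Finset.sum_range_succ']
      congr 1
      · refine Finset.sum_congr rfl fun x hx => ?_
        have := Finset.mem_range.1 hx
        rw [← add_assoc, word_insertMax_succ p σ (by omega) (by omega),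
          word_insertMax_succ p σ (by omega) (by omega), if_pos (hdesc _ (by omega) (by omega))]
      · rw [add_zero, word_insertMax_self, word_insertMax_succ p σ le_rfl (by omega),
          if_pos (word_lt σ (by omega))]
    have hold : ∑ x ∈ Finset.range r,
        (if word σ (p + x + 1) < word σ (p + x) then p + x + 1 else 0) =
        ∑ x ∈ Finset.range r, (p + x + 1) := by
      refine Finset.sum_congr rfl fun x hx => ?_
      have := Finset.mem_range.1 hx
      rw [if_pos (hdesc _ (by omega) (by omega))]
    have hsplit : Finset.range (n + 1) = Finset.range (p + (r + 1)) :=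
      congrArg Finset.range (by omega)
    have hsplit' : Finset.range n = Finset.range (p + r) := by rw [← hr]
    rw [hsplit, hsplit', Finset.sum_range_add _ _ (r + 1), Finset.sum_range_add _ _ r, hnew, hold,
      Finset.sum_add_distrib (g := fun _ => 1)]
    simp only [Finset.sum_const, Finset.card_range, smul_eq_mul, mul_one]
    rcases Nat.eq_zero_or_pos (p : ℕ) with h0 | h0
    · rw [if_pos (by omega), h0]
      simp only [Finset.range_zero, Finset.sum_empty]
      omega
    · obtain ⟨t, ht⟩ := Nat.exists_eq_succ_of_ne_zero h0.ne'
      have e : ∀ f : ℕ → ℕ, ∑ i ∈ Finset.range p, f i = ∑ i ∈ Finset.range t, f i + f t :=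
        fun f => by rw [ht, Finset.sum_range_succ]
      rw [e, e, hbelow t (by omega), if_neg (hasc t (by omega))]
      by_cases hmp : m = p
      · have hge : ¬ word σ (t + 1) < word σ t := by
          rw [show t + 1 = m by omega, hlast]
          have := word_lt σ (by omega : t < n + 1)
          omega
        rw [if_neg hge, if_pos hmp]
        omega
      · rw [if_pos (hdesc t (by omega) (by omega)), if_neg hmp]
        omega

/-- The exponent `maj σ + maj σ⁻¹`. -/
def majSum (σ : Equiv.Perm (Fin n)) : ℕ :=
  maj σ + maj (σ⁻¹ : Equiv.Perm (Fin n))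

lemma majSum_insertMax (p : Fin (n + 2)) (σ : Equiv.Perm (Fin (n + 1))) (h : Avoids312 σ)
    (hp : (σ⁻¹ (Fin.last n)).castSucc ≤ p) :
    majSum (insertMax p σ) =
      majSum σ + if (σ⁻¹ (Fin.last n)).castSucc = p then 2 * (n + 1) else n + 1 - p := by
  rw [majSum, majSum, maj_insertMax p σ h hp, maj_insertMax_inv p σ hp]
  split_ifs <;> ring

variable {K : Type*} [Field K]

/-- The generating function of `312`-avoiding permutations by `majSum`, refined by the number of
letters after the maximum. -/
def refinedSum (q : K) (n : ℕ) (f : ℕ → K) : K :=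
  ∑ σ : Equiv.Perm (Fin (n + 1)) with Avoids312 σ,
    q ^ majSum σ * f (n - σ⁻¹ (Fin.last n))

lemma refinedSum_succ (q : K) (n : ℕ) (f : ℕ → K) :
    refinedSum q (n + 1) f = refinedSum q n fun r =>
      ∑ j ∈ Finset.range (r + 1), q ^ j * f j + q ^ (2 * (n + 1)) * f (r + 1) := by
  rw [refinedSum, refinedSum, Finset.sum_filter, Finset.sum_filter,
    ← insertMax_bijective.sum_comp, Fintype.sum_prod_type_right]
  refine Finset.sum_congr rfl fun σ _ => ?_
  simp only [avoids312_insertMax_iff, insertMax_inv_last]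
  by_cases h : Avoids312 σ
  swap
  · simp [h]
  rw [if_pos h]
  have hterm : ∀ p : Fin (n + 2),
      (if Avoids312 σ ∧ (σ⁻¹ (Fin.last n)).castSucc ≤ p
        then q ^ majSum (insertMax p σ) * f (n + 1 - p) else 0) =
      q ^ majSum σ * if ((σ⁻¹ (Fin.last n) : Fin (n + 1)) : ℕ) ≤ p then
        (if ((σ⁻¹ (Fin.last n) : Fin (n + 1)) : ℕ) = p then q ^ (2 * (n + 1))
          else q ^ (n + 1 - (p : ℕ))) * f (n + 1 - p) else 0 := fun p => by
    by_cases hp : (σ⁻¹ (Fin.last n)).castSucc ≤ p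
    · rw [if_pos ⟨h, hp⟩, if_pos (by exact hp), majSum_insertMax p σ h hp, pow_add, mul_assoc]
      simp only [Fin.ext_iff, Fin.val_castSucc]
      split_ifs <;> rfl
    · rw [if_neg fun h => hp h.2, if_neg (by exact hp), mul_zero]
  rw [Finset.sum_congr rfl fun p _ => hterm p, ← Finset.mul_sum]
  congr 1
  have hm : ((σ⁻¹ (Fin.last n) : Fin (n + 1)) : ℕ) < n + 1 := Fin.is_lt _
  generalize ((σ⁻¹ (Fin.last n) : Fin (n + 1)) : ℕ) = m at *
  rw [← Finset.sum_range fun p => if m ≤ p then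
    (if m = p then q ^ (2 * (n + 1)) else q ^ (n + 1 - p)) * f (n + 1 - p) else 0,
    -- Reindex by the number of letters after the new maximum.
    ← Finset.sum_range_reflect]
  obtain ⟨r, rfl⟩ := Nat.exists_eq_add_of_le (Nat.lt_succ_iff.1 hm)
  rw [show m + r + 1 + 1 = (r + 1 + 1) + m by ring, Finset.sum_range_add, Finset.sum_range_succ,
    Finset.sum_eq_zero (s := Finset.range m), add_zero, show m + r - m = r by omega]
  · congr 1
    · refine Finset.sum_congr rfl fun j hj => ?_
      have := Finset.mem_range.1 hj
      rw [if_pos (by omega), if_neg (by omega)]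
      congr 2 <;> omega
    · rw [if_pos (by omega), if_pos (by omega)]
      congr 2
      omega
  · intro x hx
    have := Finset.mem_range.1 hx
    rw [if_neg (by omega)]

end Insertion

/-! ### Solving the recurrence in closed form. -/

section ClosedForm

variable {K : Type*} [Field K]

/-- The generating function by `majSum` of the `312`-avoiding permutations of `n` letters with at
least `j` letters after the maximum. -/
def tailSum (q : K) (n j : ℕ) : K :=
  if j < n then q ^ (n * j) * qPochhammer q q (n + (n - 1 - j)) /
    (qPochhammer q q (n + 1) * qPochhammer q q (n - 1 - j)) *
      (1 - q ^ (j + 1) + q ^ n - q ^ (n + 1)) else 0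

lemma tailSum_of_le (q : K) {n j : ℕ} (h : n ≤ j) : tailSum q n j = 0 :=
  if_neg h.not_gt

lemma tailSum_of_eq (q : K) {n j k : ℕ} (h : n = j + 1 + k) :
    tailSum q n j = q ^ (n * j) * qPochhammer q q (n + k) /
      (qPochhammer q q (n + 1) * qPochhammer q q k) *
        (1 - q ^ (j + 1) + q ^ n - q ^ (n + 1)) := by
  rw [tailSum, if_pos (by omega), show n - 1 - j = k by omega]

lemma qPochhammer_succ (q : K) (n : ℕ) :
    qPochhammer q q (n + 1) = qPochhammer q q n * (1 - q ^ (n + 1)) := by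
  rw [qPochhammer, Finset.prod_range_succ, pow_succ]
  rfl

variable {q : K}

lemma qPochhammer_ne_zero (hq : ∀ n, 1 - q ^ (n + 1) ≠ 0) (n : ℕ) :
    qPochhammer q q n ≠ 0 := by
  rw [qPochhammer, Finset.prod_ne_zero_iff]
  intro i _
  rw [← pow_succ]
  exact hq i

lemma tailSum_last (hq : ∀ n, 1 - q ^ (n + 1) ≠ 0) (j : ℕ) :
    tailSum q (j + 1) j = q ^ ((j + 1) * j) := by
  rw [tailSum_of_eq q (k := 0) rfl, qPochhammer_succ q (j + 1), add_zero]
  have := qPochhammer_ne_zero hq (j + 1)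
  have h1 := hq (j + 1)
  rw [show qPochhammer q q 0 = 1 from Finset.prod_range_zero _]
  field_simp
  ring

/-- Recurrence for a maximum in last place: appending it leaves `majSum` unchanged. -/
lemma tailSum_succ_zero (hq : ∀ n, 1 - q ^ (n + 1) ≠ 0) (n : ℕ) :
    tailSum q (n + 2) 0 - tailSum q (n + 2) 1 = tailSum q (n + 1) 0 := by
  rw [tailSum_of_eq q (k := n + 1) (by ring), tailSum_of_eq q (k := n) (by ring),
    tailSum_of_eq q (n := n + 1) (k := n) (by ring),
    show n + 2 + (n + 1) = n + 1 + n + 1 + 1 by ring, show n + 2 + n = n + 1 + n + 1 by ring]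
  simp only [qPochhammer_succ q (n + 1 + n + 1), qPochhammer_succ q (n + 1 + n),
    qPochhammer_succ q (n + 2), qPochhammer_succ q (n + 1), qPochhammer_succ q n]
  have := qPochhammer_ne_zero hq n
  have h0 := hq n
  have h1 := hq (n + 1)
  have h2 := hq (n + 2)
  field_simp
  ring

/-- Recurrence for j + 1 letters after the maximum: the first term inserts after the old maximum,
the second immediately before it. -/
lemma tailSum_succ_succ (hq : ∀ n, 1 - q ^ (n + 1) ≠ 0) (n j : ℕ)
    (h : j < n) :
    tailSum q (n + 1) (j + 1) - tailSum q (n + 1) (j + 2) =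
      q ^ (j + 1) * tailSum q n (j + 1) +
        q ^ (2 * n) * (tailSum q n j - tailSum q n (j + 1)) := by
  rcases (Nat.succ_le_of_lt h).eq_or_lt with rfl | h
  · rw [tailSum_of_le q le_rfl, tailSum_of_le q le_rfl, tailSum_last hq, tailSum_last hq,
      Nat.succ_eq_add_one]
    ring
  · obtain ⟨k, hk⟩ := Nat.exists_eq_add_of_le h
    rw [tailSum_of_eq q (n := n + 1) (j := j + 1) (k := k + 1) (by omega),
      tailSum_of_eq q (n := n + 1) (j := j + 2) (k := k) (by omega),
      tailSum_of_eq q (n := n) (j := j) (k := k + 1) (by omega),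
      tailSum_of_eq q (n := n) (j := j + 1) (k := k) (by omega),
      show n + 1 + (k + 1) = n + k + 1 + 1 by ring, show n + 1 + k = n + k + 1 by ring,
      show n + (k + 1) = n + k + 1 by ring]
    simp only [qPochhammer_succ q (n + k + 1), qPochhammer_succ q (n + k),
      qPochhammer_succ q (n + 1), qPochhammer_succ q k]
    have hk0 := qPochhammer_ne_zero hq k
    have hn0 := qPochhammer_ne_zero hq (n + 1)
    have h0 := hq k
    have h1 := hq (n + 1)
    -- The relation n = j + 2 + k, which the final polynomial identity needs.
    have e : q ^ n = q ^ 2 * q ^ j * q ^ k := by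
      rw [hk, ← pow_add, ← pow_add]
      congr 1
      omega
    have e1 : q ^ ((n + 1) * (j + 1)) = q ^ (n * j) * q ^ n * q ^ j * q := by ring
    have e2 : q ^ ((n + 1) * (j + 2)) = q ^ (n * j) * q ^ n * q ^ n * q ^ j * q ^ 2 := by ring
    have e3 : q ^ (n * (j + 1)) = q ^ (n * j) * q ^ n := by ring
    have e4 : q ^ (2 * n) = q ^ n * q ^ n := by ring
    have e5 : q ^ (n + k + 1) = q ^ n * q ^ k * q := by ring
    rw [e1, e2, e3, e4, pow_succ q (n + k + 1), e5]
    generalize qPochhammer q q (n + 1) = Pn at *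
    generalize qPochhammer q q (n + k) = Pnk at *
    generalize qPochhammer q q k = Pk at *
    generalize ha : 1 - q ^ (k + 1) = a at *
    generalize hb : 1 - q ^ (n + 1 + 1) = b at *
    field_simp
    rw [← ha, ← hb]
    simp only [pow_succ q (n + 1), pow_succ q n, pow_succ q k, pow_succ q (j + 2),
      pow_succ q (j + 1), pow_succ q j, e]
    ring

lemma sum_range_sub_mul_sum_range (t c : ℕ → K) (n : ℕ) :
    ∑ r ∈ Finset.range n, (t r - t (r + 1)) * ∑ j ∈ Finset.range (r + 1), c j =
      ∑ j ∈ Finset.range n, (t j - t n) * c j := by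
  induction n with
  | zero => simp
  | succ n ih =>
    rw [Finset.sum_range_succ, ih, Finset.mul_sum, Finset.sum_range_succ _ n,
      Finset.sum_range_succ _ n, ← add_assoc, ← Finset.sum_add_distrib]
    congr 1
    exact Finset.sum_congr rfl fun j _ => by ring

/-- The weight f is arbitrary because `refinedSum_succ` changes it. Summation by parts turns the
inner sums into tails, and the coefficients of each f j are then compared. -/
lemma refinedSum_eq (hq : ∀ n, 1 - q ^ (n + 1) ≠ 0) (n : ℕ) (f : ℕ → K) :
    refinedSum q n f =
      ∑ j ∈ Finset.range (n + 1), (tailSum q (n + 1) j - tailSum q (n + 1) (j + 1)) * f j := by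
  induction n generalizing f with
  | zero =>
    have hav : Avoids312 (1 : Equiv.Perm (Fin 1)) := fun i j k hij => by omega
    have huniv : (Finset.univ : Finset (Equiv.Perm (Fin (0 + 1)))) = {1} := by decide
    rw [refinedSum, Finset.sum_filter, huniv, Finset.sum_singleton, Finset.sum_range_one,
      tailSum_last hq, tailSum_of_le q le_rfl, if_pos hav, majSum, inv_one, maj_eq_sum_fin]
    simp
  | succ n ih =>
    rw [refinedSum_succ, ih]
    simp only [mul_add, Finset.sum_add_distrib]
    rw [sum_range_sub_mul_sum_range, Finset.sum_range_succ' _ (n + 1), tailSum_succ_zero hq,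
      tailSum_of_le q le_rfl]
    have hshift : ∑ j ∈ Finset.range (n + 1), (tailSum q (n + 1) j - 0) * (q ^ j * f j) =
        ∑ j ∈ Finset.range (n + 1), tailSum q (n + 1) (j + 1) * (q ^ (j + 1) * f (j + 1)) +
          tailSum q (n + 1) 0 * f 0 := by
      have h := Finset.sum_range_succ (fun j => tailSum q (n + 1) j * (q ^ j * f j)) (n + 1)
      rw [Finset.sum_range_succ', tailSum_of_le q le_rfl, zero_mul, add_zero, pow_zero,
        one_mul] at h
      simp only [sub_zero]
      exact h.symm
    rw [hshift, add_right_comm, ← Finset.sum_add_distrib]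
    congr 1
    refine Finset.sum_congr rfl fun j hj => ?_
    rw [tailSum_succ_succ hq _ _ (Finset.mem_range.1 hj)]
    ring

lemma tailSum_zero (hq : ∀ n, 1 - q ^ (n + 1) ≠ 0) (n : ℕ) :
    tailSum q (n + 1) 0 = 1 / qInt q (n + 2) * qBinom q (2 * (n + 1)) (n + 1) := by
  have h1 : 1 - q ≠ 0 := by simpa using hq 0
  have hint : qInt q (n + 2) = (1 - q ^ (n + 2)) / (1 - q) := by
    rw [eq_div_iff h1]
    exact geom_sum_mul_neg q (n + 2)
  rw [tailSum_of_eq q (k := n) (by ring), hint, qBinom,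
    show 2 * (n + 1) - (n + 1) = n + 1 by omega, show 2 * (n + 1) = n + 1 + n + 1 by ring,
    qPochhammer_succ q (n + 1 + n), qPochhammer_succ q (n + 1), qPochhammer_succ q n]
  have := qPochhammer_ne_zero hq n
  have h2 := hq n
  have h3 := hq (n + 1)
  rw [show n + 1 + 1 = n + 2 by ring] at *
  field_simp
  ring

theorem sum_avoids312_eq (hq : ∀ n, 1 - q ^ (n + 1) ≠ 0) (n : ℕ) :
    ∑ σ : Equiv.Perm (Fin n) with Avoids312 σ, q ^ majSum σ =
      1 / qInt q (n + 1) * qBinom q (2 * n) n := by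
  cases n with
  | zero =>
    have hav : Avoids312 (1 : Equiv.Perm (Fin 0)) := fun i => i.elim0
    rw [Finset.sum_filter, Fintype.sum_unique,
      Subsingleton.elim default (1 : Equiv.Perm (Fin 0)), if_pos hav]
    simp [majSum, maj, descents, qInt, qBinom, qPochhammer]
  | succ n =>
    have h := refinedSum_eq hq n fun _ => 1
    simp only [refinedSum, mul_one] at h
    -- With f = 1 the differences telescope to the tail at 0.
    rw [h, Finset.sum_range_sub', tailSum_of_le q le_rfl, sub_zero, tailSum_zero hq]

end ClosedForm

lemma one_sub_ratFunc_X_pow_ne_zero (n : ℕ) : 1 - (RatFunc.X : RatFunc ℚ) ^ (n + 1) ≠ 0 := by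
  rw [← RatFunc.algebraMap_X, ← map_pow, ← map_one (algebraMap (Polynomial ℚ) (RatFunc ℚ)),
    ← map_sub]
  refine RatFunc.algebraMap_ne_zero fun h => ?_
  have := congrArg (Polynomial.eval 0) h
  simp at this

end QCatalan

theorem mainTheorem4 (n : ℕ) :
    MvPolynomial.aeval ![(RatFunc.X : RatFunc ℚ), RatFunc.X] (QCatalan.genFun n) =
      1 / QCatalan.qInt (RatFunc.X : RatFunc ℚ) (n + 1) *
        QCatalan.qBinom (RatFunc.X : RatFunc ℚ) (2 * n) n := by
  rw [← QCatalan.sum_avoids312_eq QCatalan.one_sub_ratFunc_X_pow_ne_zero, QCatalan.genFun, map_sum]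
  refine Finset.sum_congr rfl fun σ _ => ?_
  simp [QCatalan.majSum, pow_add]
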